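/- Let $F$ be a field of characteristic $\neq 2$ and let $A$ be an algebra over $F$, not necessarily commutative, associative or unital, and of arbitrary dimension. For $a\in A$ and $\mu,\eta\in F$ put $A_{\mu,\eta}(a)=\{x\in A : ax=\mu x,\ xa=\eta x\}$ and $A_0(a)=A_{0,0}(a)$. Let $\lambda,\delta\in F\setminus\{0,1\}$. A nonzero idempotent $a\in A$ is called a primitive axis of type $(\lambda,\delta)$ if $a(ya)=(ay)a$ for all $y\in A$; $\{x\in A: ax=x\}=Fa=\{x\in A: xa=x\}$; and $$A=\underbrace{Fa\oplus A_0(a)}_{\text{even part}}\oplus \underbrace{A_{\lambda,\delta}(a)}_{\text{odd part}},$$ where the even and odd parts form a $\mathbb Z/2$-grading of $A$. A primitive axis of type $(\lambda,\lambda)$ is said to be of type $\lambda$. A Frobenius form on $A$ is a nonzero bilinear form $(\cdot,\cdot):A\times A\to F$ with $(x,yz)=(xy,z)$ for all $x,y,z\in A$; its radical is $\{u\in A: (u,v)=0 \text{ for all } v\in A\}$. Theorem. Suppose that $A$ is generated as an algebra by a set of primitive axes, whose types may differ, and let $a\in A$ be a primitive axis of some type. Then at least one of the following holds: (i) $xy\in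 A_0(a)$ for all $x,y\in A_0(a)$; (ii) $a$ is of type $-1$, $-1\neq\tfrac12$ in $F$, there is a primitive axis $b\in A$ of type $2$ with $ab\neq 0$, and $a$ lies in the radical of every Frobenius form on $A$. -/

import Mathlib

/-- The joint eigenspace `A_{μ,η}(a) = {x | a x = μ x and x a = η x}`. -/
def jointEigenspace {F A : Type*} [Field F] [NonUnitalNonAssocRing A] [Module F A]
    [IsScalarTower F A A] [SMulCommClass F A A] (a : A) (μ η : F) : Submodule F A :=
  Module.End.eigenspace (LinearMap.mulLeft F a) μ ⊓
    Module.End.eigenspace (LinearMap.mulRight F a) η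

/-- The space `A_0(a) = A_{0,0}(a)`. -/
def zeroSpace (F : Type*) {A : Type*} [Field F] [NonUnitalNonAssocRing A] [Module F A]
    [IsScalarTower F A A] [SMulCommClass F A A] (a : A) : Submodule F A :=
  jointEigenspace a (0 : F) 0

/-- The `0`-part (even part) `A_1(a) + A_0(a)` with respect to `a`, where `A_1(a) = F a`. -/
def evenPart (F : Type*) {A : Type*} [Field F] [NonUnitalNonAssocRing A] [Module F A]
    [IsScalarTower F A A] [SMulCommClass F A A] (a : A) : Submodule F A :=
  Submodule.span F {a} ⊔ zeroSpace F a

/-- `a` is a primitive axis (of Jordan type) of type `(lam, del)` in the algebra `A`. -/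
structure IsPrimitiveAxis {F A : Type*} [Field F] [NonUnitalNonAssocRing A] [Module F A]
    [IsScalarTower F A A] [SMulCommClass F A A] (lam del : F) (a : A) : Prop where
  lam_ne_zero : lam ≠ 0
  lam_ne_one : lam ≠ 1
  del_ne_zero : del ≠ 0
  del_ne_one : del ≠ 1
  ne_zero : a ≠ 0
  idem : a * a = a
  /-- left and right multiplication by `a` commute -/
  comm : ∀ y : A, a * (y * a) = a * y * a
  /-- left primitivity, `A_1(L_a) = F a` -/
  left_primitive : Module.End.eigenspace (LinearMap.mulLeft F a) 1 = Submodule.span F {a}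
  /-- right primitivity, `A_1(R_a) = F a` -/
  right_primitive : Module.End.eigenspace (LinearMap.mulRight F a) 1 = Submodule.span F {a}
  /-- `A = A_1(a) ⊕ A_0(a) ⊕ A_{lam,del}(a)`; the sum is automatically direct, as the summands
  are contained in eigenspaces of `L_a` for the distinct eigenvalues `1, 0, lam` -/
  decomp : evenPart F a ⊔ jointEigenspace a lam del = ⊤
  /-- the fusion rules: the even and odd parts form a `ℤ/2`-grading of `A` -/
  even_even : ∀ x ∈ evenPart F a, ∀ y ∈ evenPart F a, x * y ∈ evenPart F a
  even_odd : ∀ x ∈ evenPart F a, ∀ y ∈ jointEigenspace a lam del,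
    x * y ∈ jointEigenspace a lam del
  odd_even : ∀ x ∈ jointEigenspace a lam del, ∀ y ∈ evenPart F a,
    x * y ∈ jointEigenspace a lam del
  odd_odd : ∀ x ∈ jointEigenspace a lam del, ∀ y ∈ jointEigenspace a lam del,
    x * y ∈ evenPart F a

/-- `A` is a primitive axial algebra of Jordan type (PAJ): it is generated, as an algebra, by a
set of primitive axes, not necessarily of the same type. -/
def IsPAJ (F A : Type*) [Field F] [NonUnitalNonAssocRing A] [Module F A]
    [IsScalarTower F A A] [SMulCommClass F A A] : Prop :=
  ∃ X : Set A, (∀ x ∈ X, ∃ lam del : F, IsPrimitiveAxis lam del x) ∧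
    NonUnitalAlgebra.adjoin F X = ⊤

/-- A Frobenius form on `A`: a nonzero bilinear form with `(x, y z) = (x y, z)`. -/
def IsFrobeniusForm {F A : Type*} [Field F] [NonUnitalNonAssocRing A] [Module F A]
    (B : LinearMap.BilinForm F A) : Prop :=
  B ≠ 0 ∧ ∀ x y z : A, B x (y * z) = B (x * y) z

/-- The radical `{u | (u, A) = 0}` of a bilinear form on `A`. -/
def formRadical {F A : Type*} [Field F] [NonUnitalNonAssocRing A] [Module F A]
    (B : LinearMap.BilinForm F A) : Set A :=
  {u | ∀ v : A, B u v = 0}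

/-! Write φ_a(y) and π_a(y) for the `a`-coordinate and the odd part of y. By the grading, τ_a = 1 -
2π_a is an automorphism; these involutions permute the axes, so axes span A (`IsPAJ.span_axes`). For
x, y in A_0(a) the product xy is even, so only φ_a(xy) can keep it out of A_0(a). It vanishes once
some τ-invariant weight c on axes has c_a ≠ 0 and c_b φ_b(d) = c_d φ_d(b) throughout: then (b, d) =
c_b φ_b(d) extends to a bilinear form with (a, xy) = (xa, y) (`mul_mem_zeroSpace_of_weight`).

Coordinates of two axes are already symmetric, except for types l ≠ 1/2 and l' = 1 - l, where they
can be (1 + l')/2 and (1 + l)/2 (`AxisData.pair_classification`). The weight 1 + l repairs this and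
fails only at l = -1. If `a` has type -1 and annihilates every axis of type 2, the indicator of such
axes is a weight. Otherwise some b of type 2 has φ_a(b) = 3/2 and φ_b(a) = 0, so every Frobenius
form gives (3/2)(a, a) = (a, b) = 0, and (a, y) = φ_a(y)(a, a) = 0. -/

/-- An element `a` together with the linear functional `φ` and the projection `π` that give the
`a`-coordinate and the odd part of an element with respect to `a`. -/
structure AxisData {F A : Type*} [Field F] [NonUnitalNonAssocRing A] [Module F A]
    (l d : F) (a : A) (φ : A →ₗ[F] F) (π : A →ₗ[F] A) : Prop where
  l_ne_zero : l ≠ 0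
  l_ne_one : l ≠ 1
  d_ne_zero : d ≠ 0
  d_ne_one : d ≠ 1
  ne_zero : a ≠ 0
  coord_self : φ a = 1
  odd_self : π a = 0
  coord_odd : ∀ y, φ (π y) = 0
  odd_odd : ∀ y, π (π y) = π y
  mul_left : ∀ y, a * y = φ y • a + l • π y
  mul_right : ∀ y, y * a = φ y • a + d • π y
  odd_mul : ∀ x y, π (x * y) = (x - π x) * π y + π x * (y - π y)

/-! ### Coordinates of an axis -/

section

variable {F A : Type*} [Field F] [NonUnitalNonAssocRing A] [Module F A]
  [IsScalarTower F A A] [SMulCommClass F A A]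

theorem mem_jointEigenspace {a x : A} {μ η : F} :
    x ∈ jointEigenspace a μ η ↔ a * x = μ • x ∧ x * a = η • x := by
  simp [jointEigenspace]

theorem mem_zeroSpace {a x : A} : x ∈ zeroSpace F a ↔ a * x = 0 ∧ x * a = 0 := by
  simp [zeroSpace, mem_jointEigenspace]

theorem mem_evenPart {a x : A} :
    x ∈ evenPart F a ↔ ∃ r : F, ∃ z ∈ zeroSpace F a, r • a + z = x := by
  simp [evenPart, Submodule.mem_sup, Submodule.mem_span_singleton]

theorem IsPrimitiveAxis.exists_axisData {l d : F} {a : A} (h : IsPrimitiveAxis l d a) :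
    ∃ φ π, AxisData l d a φ π := by
  have hl1 : l - 1 ≠ 0 := sub_ne_zero.2 h.lam_ne_one
  have hl := h.lam_ne_zero
  obtain ⟨g, hg⟩ := LinearMap.exists_leftInverse_of_injective
    (LinearMap.toSpanSingleton F A a) (LinearMap.ker_toSpanSingleton F h.ne_zero)
  have hga : g a = 1 := by simpa using LinearMap.congr_fun hg 1
  let L := LinearMap.mulLeft F a
  -- Lagrange interpolation in L: L² - lL kills the eigenvalues 0 and l, and L² - L kills 0 and 1.
  let φ : A →ₗ[F] F := (1 - l)⁻¹ • (g ∘ₗ (L ∘ₗ L - l • L))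
  let π : A →ₗ[F] A := (l * (l - 1))⁻¹ • (L ∘ₗ L - L)
  have hl1' : 1 - l ≠ 0 := sub_ne_zero.2 (Ne.symm h.lam_ne_one)
  have ev (r : F) (z w : A) (hz : z ∈ zeroSpace F a) (hw : w ∈ jointEigenspace a l d) :
      φ (r • a + z + w) = r ∧ π (r • a + z + w) = w := by
    rw [mem_zeroSpace] at hz
    rw [mem_jointEigenspace] at hw
    constructor
    · simp only [φ, L, LinearMap.smul_apply, LinearMap.comp_apply, LinearMap.sub_apply,
        LinearMap.mulLeft_apply, h.idem, hz.1, hw.1, map_sub, map_add,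
        map_smul, hga, smul_eq_mul, mul_zero, map_zero]
      field_simp
      ring
    · simp only [π, L, LinearMap.smul_apply, LinearMap.comp_apply, LinearMap.sub_apply,
        LinearMap.mulLeft_apply, mul_add, mul_smul_comm, h.idem, hz.1, hw.1, mul_zero]
      have : r • a + 0 + l • l • w - (r • a + 0 + l • w) = (l * (l - 1)) • w := by module
      rw [this, smul_smul, inv_mul_cancel₀ (mul_ne_zero hl hl1), one_smul]
  have dec (y : A) : ∃ (r : F) (z w : A), z ∈ zeroSpace F a ∧ w ∈ jointEigenspace a l d ∧
      r • a + z + w = y := by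
    have : y ∈ evenPart F a ⊔ jointEigenspace a l d := h.decomp ▸ Submodule.mem_top
    obtain ⟨e, he, w, hw, rfl⟩ := Submodule.mem_sup.1 this
    obtain ⟨r, z, hz, rfl⟩ := mem_evenPart.1 he
    exact ⟨r, z, w, hz, hw, rfl⟩
  have ev_even (x : A) (hx : x ∈ evenPart F a) : π x = 0 := by
    obtain ⟨r, z, hz, rfl⟩ := mem_evenPart.1 hx
    simpa using (ev r z 0 hz (Submodule.zero_mem _)).2
  have ev_odd (x : A) (hx : x ∈ jointEigenspace a l d) : φ x = 0 ∧ π x = x := by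
    simpa using ev 0 0 x (Submodule.zero_mem _) hx
  refine ⟨φ, π, hl, h.lam_ne_one, h.del_ne_zero, h.del_ne_one, h.ne_zero, ?_, ?_, ?_, ?_, ?_, ?_,
    ?_⟩
  · simpa using (ev 1 0 0 (Submodule.zero_mem _) (Submodule.zero_mem _)).1
  · simpa using (ev 1 0 0 (Submodule.zero_mem _) (Submodule.zero_mem _)).2
  · intro y
    obtain ⟨r, z, w, hz, hw, rfl⟩ := dec y
    rw [(ev r z w hz hw).2, (ev_odd w hw).1]
  · intro y
    obtain ⟨r, z, w, hz, hw, rfl⟩ := dec y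
    rw [(ev r z w hz hw).2, (ev_odd w hw).2]
  · intro y
    obtain ⟨r, z, w, hz, hw, rfl⟩ := dec y
    rw [(ev r z w hz hw).2, (ev r z w hz hw).1, mul_add, mul_add, mul_smul_comm, h.idem,
      (mem_zeroSpace.1 hz).1, (mem_jointEigenspace.1 hw).1, add_zero]
  · intro y
    obtain ⟨r, z, w, hz, hw, rfl⟩ := dec y
    rw [(ev r z w hz hw).2, (ev r z w hz hw).1, add_mul, add_mul, smul_mul_assoc, h.idem,
      (mem_zeroSpace.1 hz).2, (mem_jointEigenspace.1 hw).2, add_zero]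
  · intro x y
    obtain ⟨r, z, w, hz, hw, rfl⟩ := dec x
    obtain ⟨r', z', w', hz', hw', rfl⟩ := dec y
    rw [(ev r z w hz hw).2, (ev r' z' w' hz' hw').2, add_sub_cancel_right, add_sub_cancel_right]
    have he : r • a + z ∈ evenPart F a := mem_evenPart.2 ⟨r, z, hz, rfl⟩
    have he' : r' • a + z' ∈ evenPart F a := mem_evenPart.2 ⟨r', z', hz', rfl⟩
    generalize r • a + z = e at *
    generalize r' • a + z' = e' at *
    rw [add_mul, mul_add, mul_add, map_add, map_add, map_add, ev_even _ (h.even_even _ he _ he'),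
      ev_even _ (h.odd_odd _ hw _ hw'), (ev_odd _ (h.even_odd _ he _ hw')).2,
      (ev_odd _ (h.odd_even _ hw _ he')).2]
    abel

end

namespace AxisData

section

variable {F A : Type*} [Field F] [NonUnitalNonAssocRing A] [Module F A]
  {l d : F} {a : A} {φ : A →ₗ[F] F} {π : A →ₗ[F] A}

theorem idem (D : AxisData l d a φ π) : a * a = a := by
  rw [D.mul_left, D.coord_self, D.odd_self]; simp

theorem mul_odd (D : AxisData l d a φ π) (y : A) : a * π y = l • π y := by
  rw [D.mul_left, D.coord_odd, D.odd_odd, zero_smul, zero_add]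

theorem odd_mul_self (D : AxisData l d a φ π) (y : A) : π y * a = d • π y := by
  rw [D.mul_right, D.coord_odd, D.odd_odd, zero_smul, zero_add]

theorem eq_smul_of_mul_left_eq (D : AxisData l d a φ π) {y : A} (h : a * y = y) :
    y = φ y • a := by
  have h1 := D.mul_left y
  rw [h] at h1
  have h2 := congrArg π h1
  simp only [map_add, map_smul, D.odd_self, D.odd_odd, smul_zero, zero_add] at h2
  have h3 : (1 - l) • π y = 0 := by rw [sub_smul, one_smul, sub_eq_zero]; exact h2
  have h4 := (smul_eq_zero.1 h3).resolve_left (sub_ne_zero.2 D.l_ne_one.symm)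
  rwa [h4, smul_zero, add_zero] at h1

theorem eq_smul_of_mul_right_eq (D : AxisData l d a φ π) {y : A} (h : y * a = y) :
    y = φ y • a := by
  have h1 := D.mul_right y
  rw [h] at h1
  have h2 := congrArg π h1
  simp only [map_add, map_smul, D.odd_self, D.odd_odd, smul_zero, zero_add] at h2
  have h3 : (1 - d) • π y = 0 := by rw [sub_smul, one_smul, sub_eq_zero]; exact h2
  have h4 := (smul_eq_zero.1 h3).resolve_left (sub_ne_zero.2 D.d_ne_one.symm)
  rwa [h4, smul_zero, add_zero] at h1

theorem mul_left_eq_smul_iff (D : AxisData l d a φ π) {y : A} :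
    a * y = φ y • a ↔ π y = 0 := by
  rw [D.mul_left, add_eq_left, smul_eq_zero, or_iff_right D.l_ne_zero]

/-- The coordinate functional of an axis of given type is unique. -/
theorem coord_unique (D : AxisData l d a φ π) {φ' : A →ₗ[F] F} {π' : A →ₗ[F] A}
    (D' : AxisData l d a φ' π') : φ = φ' := by
  ext y
  have e1 : a * (a * y) = φ y • a + l • l • π y := by
    rw [D.mul_left y]
    rw [D.mul_left]
    simp [D.coord_self, D.odd_self, D.coord_odd, D.odd_odd]
  have e2 : a * (a * y) = φ' y • a + l • l • π' y := by
    rw [D'.mul_left y]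
    rw [D'.mul_left]
    simp [D'.coord_self, D'.odd_self, D'.coord_odd, D'.odd_odd]
  have e3 : ((1 - l) * (φ y - φ' y)) • a = 0 := by
    have := D.mul_left y
    rw [D'.mul_left y] at this
    rw [e1] at e2
    linear_combination (norm := module) e2 + l • this
  have := (mul_eq_zero.1 ((smul_eq_zero.1 e3).resolve_right D.ne_zero)).resolve_left
    (sub_ne_zero.2 D.l_ne_one.symm)
  exact sub_eq_zero.1 this

theorem miyamoto_miyamoto (D : AxisData l d a φ π) (y : A) :
    y - (2 : F) • π y - (2 : F) • π (y - (2 : F) • π y) = y := by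
  rw [map_sub, map_smul, D.odd_odd]
  module

/-- Transport of an axis along an involutive automorphism. -/
theorem map (D : AxisData l d a φ π) (τ : A →ₗ[F] A) (hτ : ∀ x y, τ (x * y) = τ x * τ y)
    (hττ : ∀ x, τ (τ x) = x) : AxisData l d (τ a) (φ ∘ₗ τ) (τ ∘ₗ π ∘ₗ τ) where
  l_ne_zero := D.l_ne_zero
  l_ne_one := D.l_ne_one
  d_ne_zero := D.d_ne_zero
  d_ne_one := D.d_ne_one
  ne_zero h := D.ne_zero (by rw [← hττ a, h, map_zero])
  coord_self := by simp [hττ, D.coord_self]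
  odd_self := by simp [hττ, D.odd_self]
  coord_odd y := by simp [hττ, D.coord_odd]
  odd_odd y := by simp [hττ, D.odd_odd]
  mul_left y := by
    have := congrArg τ (D.mul_left (τ y))
    simpa [hτ, hττ] using this
  mul_right y := by
    have := congrArg τ (D.mul_right (τ y))
    simpa [hτ, hττ] using this
  odd_mul x y := by
    have := congrArg τ (D.odd_mul (τ x) (τ y))
    simpa [hτ, hττ] using this

end

section

variable {F A : Type*} [Field F] [NonUnitalNonAssocRing A] [Module F A]
  [IsScalarTower F A A] [SMulCommClass F A A]
  {l d : F} {a : A} {φ : A →ₗ[F] F} {π : A →ₗ[F] A}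

theorem mem_zeroSpace_iff (D : AxisData l d a φ π) {y : A} :
    y ∈ zeroSpace F a ↔ φ y = 0 ∧ π y = 0 := by
  rw [mem_zeroSpace]
  constructor
  · rintro ⟨h, -⟩
    rw [D.mul_left] at h
    have h2 := congrArg φ h
    have h3 := congrArg π h
    simp only [map_add, map_smul, D.odd_self, D.odd_odd, D.coord_self, D.coord_odd, map_zero,
      smul_zero, smul_eq_mul, mul_one, mul_zero, zero_add, add_zero, smul_eq_zero,
      D.l_ne_zero, false_or] at h2 h3
    exact ⟨h2, h3⟩
  · rintro ⟨h1, h2⟩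
    rw [D.mul_left, D.mul_right, h1, h2]
    simp

theorem mem_evenPart_iff (D : AxisData l d a φ π) {y : A} :
    y ∈ evenPart F a ↔ π y = 0 := by
  rw [mem_evenPart]
  constructor
  · rintro ⟨r, z, hz, rfl⟩
    rw [map_add, map_smul, D.odd_self, (D.mem_zeroSpace_iff.1 hz).2, smul_zero, add_zero]
  · intro h
    refine ⟨φ y, y - φ y • a, D.mem_zeroSpace_iff.2 ?_, by abel⟩
    simp [D.coord_self, D.odd_self, h]

theorem mem_jointEigenspace_iff (D : AxisData l d a φ π) {y : A} :
    y ∈ jointEigenspace a l d ↔ π y = y := by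
  rw [mem_jointEigenspace]
  constructor
  · rintro ⟨h, -⟩
    have h0 := h
    rw [D.mul_left] at h
    have h2 := congrArg φ h
    simp only [map_add, map_smul, D.coord_self, D.coord_odd, smul_eq_mul, mul_one, mul_zero,
      add_zero] at h2
    have h3 : φ y = 0 := by
      by_contra hne
      exact D.l_ne_one (mul_right_cancel₀ hne (by rw [one_mul]; exact h2.symm))
    rw [h3, zero_smul, zero_add] at h
    exact smul_right_injective A D.l_ne_zero h
  · intro h
    rw [← h]
    exact ⟨D.mul_odd y, D.odd_mul_self y⟩

theorem isPrimitiveAxis (D : AxisData l d a φ π) : IsPrimitiveAxis l d a where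
  lam_ne_zero := D.l_ne_zero
  lam_ne_one := D.l_ne_one
  del_ne_zero := D.d_ne_zero
  del_ne_one := D.d_ne_one
  ne_zero := D.ne_zero
  idem := D.idem
  comm y := by
    rw [D.mul_right, D.mul_left y, add_mul, mul_add, mul_smul_comm, mul_smul_comm,
      smul_mul_assoc, smul_mul_assoc, D.mul_odd, D.odd_mul_self, D.idem, smul_comm d l]
  left_primitive := by
    ext y
    rw [Module.End.mem_eigenspace_iff, Submodule.mem_span_singleton, LinearMap.mulLeft_apply,
      one_smul]
    constructor
    · exact fun h => ⟨φ y, (D.eq_smul_of_mul_left_eq h).symm⟩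
    · rintro ⟨r, rfl⟩
      rw [mul_smul_comm, D.idem]
  right_primitive := by
    ext y
    rw [Module.End.mem_eigenspace_iff, Submodule.mem_span_singleton, LinearMap.mulRight_apply,
      one_smul]
    constructor
    · exact fun h => ⟨φ y, (D.eq_smul_of_mul_right_eq h).symm⟩
    · rintro ⟨r, rfl⟩
      rw [smul_mul_assoc, D.idem]
  decomp := by
    rw [eq_top_iff]
    intro y _
    refine Submodule.mem_sup.2 ⟨y - π y, D.mem_evenPart_iff.2 ?_, π y,
      D.mem_jointEigenspace_iff.2 (D.odd_odd y), by abel⟩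
    rw [map_sub, D.odd_odd, sub_self]
  even_even x hx y hy := by
    rw [D.mem_evenPart_iff] at *
    simp [D.odd_mul, hx, hy]
  even_odd x hx y hy := by
    rw [D.mem_evenPart_iff] at hx
    rw [D.mem_jointEigenspace_iff] at *
    simp [D.odd_mul, hx, hy]
  odd_even x hx y hy := by
    rw [D.mem_evenPart_iff] at hy
    rw [D.mem_jointEigenspace_iff] at *
    simp [D.odd_mul, hx, hy]
  odd_odd x hx y hy := by
    rw [D.mem_jointEigenspace_iff] at hx hy
    rw [D.mem_evenPart_iff] at *
    simp [D.odd_mul, hx, hy]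

/-- The Miyamoto involution `y ↦ y - 2 π(y)` is multiplicative. -/
theorem miyamoto_mul (D : AxisData l d a φ π) (x y : A) :
    x * y - (2 : F) • π (x * y) = (x - (2 : F) • π x) * (y - (2 : F) • π y) := by
  rw [D.odd_mul]
  simp only [sub_mul, mul_sub, smul_mul_assoc, mul_smul_comm, smul_sub, smul_add]
  module

theorem eq_of_smul (D : AxisData l d a φ π) {r : F} {b : A} (hb : b ≠ 0) (hbb : b * b = b)
    (h : b = r • a) : a = b := by
  have hr : r ≠ 0 := by rintro rfl; exact hb (by rw [h, zero_smul])
  have : (r * r - r) • a = 0 := by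
    rw [h, smul_mul_assoc, mul_smul_comm, D.idem] at hbb
    rw [sub_smul, mul_smul, hbb, sub_self]
  have := (smul_eq_zero.1 this).resolve_right D.ne_zero
  have : r = 1 := mul_right_cancel₀ hr (by rw [one_mul]; exact sub_eq_zero.1 this)
  rw [h, this, one_smul]

/-! ### Pairs of axes: orthogonality and noncommutative types -/

variable {l' d' : F} {b : A} {φ' : A →ₗ[F] F} {π' : A →ₗ[F] A}

/-- Two axes, one of which has no odd part with respect to the other, are equal or orthogonal. -/
theorem eq_or_orthogonal (D : AxisData l d a φ π) (D' : AxisData l' d' b φ' π')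
    (h : π b = 0) : a = b ∨ (φ b = 0 ∧ φ' a = 0 ∧ a * b = 0 ∧ b * a = 0) := by
  have hab : a * b = φ b • a := D.mul_left_eq_smul_iff.2 h
  have hba : b * a = φ b • a := by rw [D.mul_right, h, smul_zero, add_zero]
  have h1 := D'.mul_left a
  rw [hba] at h1
  have hg : φ b * φ' a = φ' a := by
    have := congrArg φ' h1
    simpa [D'.coord_self, D'.coord_odd] using this
  by_cases h0 : φ b = 0
  · right
    rw [h0, zero_smul] at hab hba
    rw [h0, zero_mul] at hg
    exact ⟨h0, hg.symm, hab, hba⟩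
  by_cases h2 : φ b = 1
  · left
    rw [h2, one_smul] at hba
    exact (D'.eq_of_smul D.ne_zero D.idem (D'.eq_smul_of_mul_left_eq hba)).symm
  -- If φ_a(b) is neither 0 nor 1, then `a` is odd with respect to b; but a = aa is a product of odd
  -- elements, hence even.
  exfalso
  have hg0 : φ' a = 0 := by
    by_contra hne
    exact h2 (mul_right_cancel₀ hne (by rw [one_mul]; exact hg))
  rw [hg0, zero_smul, zero_add] at h1
  have h3 : π' a = a := by
    have : a = (φ b)⁻¹ • l' • π' a := by rw [← h1, smul_smul, inv_mul_cancel₀ h0, one_smul]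
    rw [this]
    simp [D'.odd_odd]
  have h4 := D'.odd_mul a a
  rw [D.idem, h3, sub_self, zero_mul, mul_zero, add_zero] at h4
  exact D.ne_zero h4

-- Comparing the two expressions for ab and for ba makes π_a(b) and π_b(a) proportional, so both
-- coordinates vanish on both. With f = φ_a(b) and g = φ_b(a), applying φ_a and φ_b to ab gives gf =
-- f and g = fg.
omit [IsScalarTower F A A] [SMulCommClass F A A] in
theorem coord_eq_of_noncomm (D : AxisData l d a φ π) (D' : AxisData l' d' b φ' π')
    (hld : l ≠ d) (hld' : l' ≠ d') : φ b = φ' a := by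
  have e1 : a * b = φ b • a + l • π b := D.mul_left b
  have e2 : b * a = φ b • a + d • π b := D.mul_right b
  have e3 : b * a = φ' a • b + l' • π' a := D'.mul_left a
  have e4 : a * b = φ' a • b + d' • π' a := D'.mul_right a
  rw [e4] at e1
  rw [e3] at e2
  have e5 : (l - d) • π b = (d' - l') • π' a := by
    linear_combination (norm := module) e2 - e1
  have c1 : φ (π' a) = 0 := by
    have := congrArg φ e5
    simpa [D.coord_odd, sub_ne_zero.2 hld'.symm] using this
  have c2 : φ' (π b) = 0 := by
    have := congrArg φ' e5
    simpa [D'.coord_odd, sub_ne_zero.2 hld] using this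
  have r1 := congrArg φ e1
  have r2 := congrArg φ' e1
  simp only [map_add, map_smul, smul_eq_mul, D.coord_self, D'.coord_self, D.coord_odd,
    D'.coord_odd, c1, c2] at r1 r2
  linear_combination -r1 - r2

/-- Commutativity of multiplication by b gives (l - d)π_a(b) = 0. -/
theorem coord_eq_of_ne (D : AxisData l d a φ π) (D' : AxisData l' d' b φ' π')
    (hld : l ≠ d) (hld' : l' = d') : a = b ∨ (φ b = 0 ∧ φ' a = 0) := by
  subst hld'
  have e1 : a * b = b * a := by rw [D'.mul_left, D'.mul_right]
  rw [D.mul_left, D.mul_right, add_right_inj, ← sub_eq_zero, ← sub_smul] at e1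
  have := (smul_eq_zero.1 e1).resolve_left (sub_ne_zero.2 hld)
  exact (D.eq_or_orthogonal D' this).imp_right fun h => ⟨h.1, h.2.1⟩

end

end AxisData

/-! ### Pairs of axes of commutative type -/

namespace AxisData

section

variable {F A : Type*} [Field F] [NonUnitalNonAssocRing A] [Module F A]
  [IsScalarTower F A A] [SMulCommClass F A A]
  {l l' : F} {a b : A} {φ φ' : A →ₗ[F] F} {π π' : A →ₗ[F] A}

omit [IsScalarTower F A A] [SMulCommClass F A A] in
theorem odd_smul_comm (D : AxisData l l a φ π) (D' : AxisData l' l' b φ' π') :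
    φ b • a + l • π b = φ' a • b + l' • π' a := by
  rw [← D.mul_left, ← D'.mul_right]

/-- This is the odd part of bb = b, as b commutes with π_a(b), a combination of a, b and π_b(a). -/
theorem two_smul_odd_mul_odd (D : AxisData l l a φ π) (D' : AxisData l' l' b φ' π') :
    (2 : F) • (π b * π b) = (2 : F) • (b * π b) - π b := by
  have e1 : b * π b = π b * b := by
    have : π b = l⁻¹ • (φ' a • b + l' • π' a - φ b • a) := by
      rw [← D.odd_smul_comm D', add_sub_cancel_left, smul_smul, inv_mul_cancel₀ D.l_ne_zero,
        one_smul]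
    rw [this, mul_smul_comm, smul_mul_assoc, mul_sub, mul_add, sub_mul, add_mul]
    simp only [mul_smul_comm, smul_mul_assoc, D'.mul_odd, D'.odd_mul_self]
    rw [D'.mul_left a, D'.mul_right a]
  have e2 := D.odd_mul b b
  rw [D'.idem, sub_mul, mul_sub, ← e1] at e2
  linear_combination (norm := module) e2

/-- The square of the odd part of `b` with respect to `a`. -/
theorem smul_odd_mul_odd (D : AxisData l l a φ π) (D' : AxisData l' l' b φ' π') :
    (2 * l) • (π b * π b) = (2 * l' - 2 * φ b - 1) • (a * b) + (2 * φ' a * (1 - l')) • b +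
      φ b • a := by
  have h1 := D.two_smul_odd_mul_odd D'
  have h2 : l • (b * π b) = φ' a • b + l' • l' • π' a - φ b • (a * b) := by
    have h3 := congrArg (fun x => b * x) (D.odd_smul_comm D')
    simp only [mul_add, mul_smul_comm, D'.mul_odd, D'.idem] at h3
    rw [D'.mul_left a, ← D'.mul_right a] at h3
    rw [← h3]
    abel
  have h4 : a * b = φ b • a + l • π b := D.mul_left b
  have h5 : a * b = φ' a • b + l' • π' a := D'.mul_right a
  linear_combination (norm := module) l • h1 + (2 : F) • h2 + h4 - (2 * l') • h5

/-- The square of π_a(b) is even, so the odd part of the formula for it vanishes. -/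
theorem type_relation (D : AxisData l l a φ π) (D' : AxisData l' l' b φ' π') (h : π b ≠ 0) :
    l * (2 * l' - 2 * φ b - 1) + 2 * φ' a * (1 - l') = 0 := by
  have h1 := congrArg π (D.smul_odd_mul_odd D')
  rw [D.mul_left b] at h1
  simp only [map_smul, map_add, D.odd_mul, D.odd_odd, D.odd_self, sub_self, zero_mul, mul_zero,
    smul_zero, add_zero, zero_add] at h1
  rw [smul_smul, ← add_smul] at h1
  have := (smul_eq_zero.1 h1.symm).resolve_right h
  linear_combination this

/-- Used with the roles of a and b exchanged as well: since ab = ba, subtracting the two formulas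
leaves a linear relation between ab, a and b. -/
theorem two_smul_mul_self (D : AxisData l l a φ π) (D' : AxisData l' l' b φ' π') :
    (2 : F) • (a * b * (a * b)) = (l * (2 * l' + 2 * φ b - 1)) • (a * b) +
      (l * (2 * φ' a * (1 - l'))) • b +
      (2 * φ b ^ 2 - 4 * φ b ^ 2 * l + l * φ b) • a := by
  have h1 := D.smul_odd_mul_odd D'
  have h2 : a * b = φ b • a + l • π b := D.mul_left b
  have h3 : a * b * (a * b) = (φ b • a + l • π b) * (φ b • a + l • π b) := by rw [h2]
  simp only [mul_add, add_mul, mul_smul_comm, smul_mul_assoc, D.idem, D.mul_odd,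
    D.odd_mul_self] at h3
  linear_combination (norm := module) (2 : F) • h3 + l • h1 - (4 * φ b * l) • h2

/-- Here b - π_a(b) is a multiple of a, so the odd part of bb = b determines φ_a(b). -/
theorem dependent_relation (D : AxisData l l a φ π) (D' : AxisData l' l' b φ' π')
    (h : π b ≠ 0) {r s : F} (hrs : a * b = r • a + s • b) :
    s = l ∧ φ b = r + l * φ b ∧ 2 * φ b * l = 1 := by
  have e1 := D.mul_left b
  rw [hrs] at e1
  have e2 := congrArg π e1
  simp only [map_add, map_smul, D.odd_self, D.odd_odd, smul_zero, zero_add] at e2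
  have hs : s = l := smul_left_injective F h e2
  subst hs
  have e3 := congrArg φ e1
  simp only [map_add, map_smul, D.coord_self, D.coord_odd, smul_eq_mul, mul_one, mul_zero,
    add_zero] at e3
  have e4 : b - π b = φ b • a := by
    apply smul_right_injective A D.l_ne_zero
    have : (φ b - r - s * φ b) • a = 0 := by
      rw [show φ b - r - s * φ b = 0 by linear_combination -e3, zero_smul]
    dsimp only
    linear_combination (norm := module) e1 + this
  have e5 := D.odd_mul b b
  rw [D'.idem, e4, smul_mul_assoc, mul_smul_comm, D.mul_odd, D.odd_mul_self] at e5
  refine ⟨rfl, e3.symm, smul_left_injective F h ?_⟩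
  dsimp only
  linear_combination (norm := module) -e5

/-- The relation between two axes of types `(l, l)` and `(l', l')`. -/
theorem pair_classification (h2 : (2 : F) ≠ 0) (D : AxisData l l a φ π)
    (D' : AxisData l' l' b φ' π') :
    a = b ∨ (φ b = 0 ∧ φ' a = 0 ∧ a * b = 0 ∧ b * a = 0) ∨ (l = l' ∧ φ b = φ' a) ∨
      (l + l' = 1 ∧ l ≠ 1 / 2 ∧ φ b = (1 + l') / 2 ∧ φ' a = (1 + l) / 2) := by
  by_cases hu : π b = 0
  · exact (D.eq_or_orthogonal D' hu).imp_right Or.inl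
  by_cases hv : π' a = 0
  · rcases D'.eq_or_orthogonal D hv with h | ⟨h, h', h'', h3⟩
    · exact Or.inl h.symm
    · exact Or.inr (Or.inl ⟨h', h, h3, h''⟩)
  right; right
  have r1 := D.type_relation D' hu
  have r2 := D'.type_relation D hv
  have hc : b * a = a * b := by rw [D.mul_left, D.mul_right]
  have q1 := D.two_smul_mul_self D'
  have q2 := D'.two_smul_mul_self D
  rw [hc] at q2
  set f := φ b
  set g := φ' a
  -- This is the coefficient of ab in the difference of the two formulas for 2(ab)².
  by_cases hZ : l * (2 * l' + 2 * f - 1) - l' * (2 * l + 2 * g - 1) = 0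
  -- Up to a factor 4, l + l' - 1 is the determinant of `r1`, `r2` as a linear system in f and g.
  · by_cases hD : l + l' - 1 = 0
    · have hl' : l' = 1 - l := by linear_combination hD
      subst hl'
      have hg : 2 * g = 2 * f - 1 + 2 * l := by
        apply mul_left_cancel₀ D.l_ne_zero
        linear_combination r1
      have hf : (2 * l - 1) * (2 * f - 2 + l) = 0 := by
        linear_combination hZ + (1 - l) * hg
      by_cases hl : 2 * l - 1 = 0
      · left
        have hl : l = 1 / 2 := by field_simp; linear_combination hl
        refine ⟨by subst hl; field_simp; ring, mul_left_cancel₀ h2 ?_⟩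
        rw [hg, hl]
        field_simp
        ring
      · right
        have hf := (mul_eq_zero.1 hf).resolve_left hl
        refine ⟨by ring, fun h => hl (by rw [h]; field_simp; ring), ?_, ?_⟩
        · field_simp
          linear_combination hf
        · field_simp
          linear_combination hf + hg
    · left
      have hf : 2 * f = l' := by
        apply mul_left_cancel₀ hD
        linear_combination (-l') * r1 - (1 - l') * r2
      have hg : 2 * g = l := by
        apply mul_left_cancel₀ hD
        linear_combination (-(1 - l)) * r1 - l * r2
      have hll : l = l' := by linear_combination -hZ + l * hf - l' * hg
      exact ⟨hll, mul_left_cancel₀ h2 (by rw [hf, hg, hll])⟩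
  · left
    set Z := l * (2 * l' + 2 * f - 1) - l' * (2 * l + 2 * g - 1)
    obtain ⟨r, s, hrs⟩ : ∃ r s : F, Z • (a * b) = r • a + s • b := by
      refine ⟨l' * (2 * f * (1 - l)) - (2 * f ^ 2 - 4 * f ^ 2 * l + l * f),
        (2 * g ^ 2 - 4 * g ^ 2 * l' + l' * g) - l * (2 * g * (1 - l')), ?_⟩
      linear_combination (norm := module) q2 - q1
    have hrs : a * b = (Z⁻¹ * r) • a + (Z⁻¹ * s) • b := by
      rw [mul_smul, mul_smul, ← smul_add, ← hrs, smul_smul, inv_mul_cancel₀ hZ, one_smul]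
    have hrs' : b * a = (Z⁻¹ * s) • b + (Z⁻¹ * r) • a := by rw [hc, hrs, add_comm]
    obtain ⟨s1, f1, f2⟩ := D.dependent_relation D' hu hrs
    obtain ⟨s2, g1, g2⟩ := D'.dependent_relation D hv hrs'
    rw [s2] at f1
    rw [s1] at g1
    have hll : l = l' := by
      linear_combination (1 - l) * f2 - 2 * l * f1 - (1 - l') * g2 + 2 * l' * g1
    subst hll
    refine ⟨rfl, mul_left_cancel₀ (mul_ne_zero h2 D.l_ne_zero) ?_⟩
    linear_combination f2 - g2

end

end AxisData

/-! ### Miyamoto involutions and the span of the axes -/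

section

variable (F : Type*) {A : Type*} [Field F] [NonUnitalNonAssocRing A] [Module F A]
  [IsScalarTower F A A] [SMulCommClass F A A]

/-- `a` is a primitive axis of some type. -/
def IsAxis (a : A) : Prop := ∃ l d : F, IsPrimitiveAxis l d a

/-- A chosen type of the axis `a`; the type is not unique when the odd part of `a` is zero. -/
noncomputable def axisType (a : A) : F × F :=
  Classical.epsilon fun p : F × F => IsPrimitiveAxis p.1 p.2 a

/-- The coordinate functional of the axis `a`. -/
noncomputable def axisCoord (a : A) : A →ₗ[F] F :=
  Classical.epsilon fun φ : A →ₗ[F] F =>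
    ∃ π, AxisData (axisType F a).1 (axisType F a).2 a φ π

/-- The projection to the odd part with respect to the axis `a`. -/
noncomputable def axisOdd (a : A) : A →ₗ[F] A :=
  Classical.epsilon fun π : A →ₗ[F] A =>
    AxisData (axisType F a).1 (axisType F a).2 a (axisCoord F a) π

/-- The Miyamoto involution of the axis `a`. -/
noncomputable def miyamoto (a : A) : A →ₗ[F] A := LinearMap.id - (2 : F) • axisOdd F a

theorem miyamoto_apply (a y : A) : miyamoto F a y = y - (2 : F) • axisOdd F a y := by
  simp [miyamoto]

variable {F} {a b : A}

theorem IsAxis.isPrimitiveAxis (ha : IsAxis F a) :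
    IsPrimitiveAxis (axisType F a).1 (axisType F a).2 a := by
  obtain ⟨l, d, h⟩ := ha
  exact Classical.epsilon_spec (p := fun p : F × F => IsPrimitiveAxis p.1 p.2 a) ⟨(l, d), h⟩

theorem IsAxis.axisData (ha : IsAxis F a) :
    AxisData (axisType F a).1 (axisType F a).2 a (axisCoord F a) (axisOdd F a) :=
  Classical.epsilon_spec (p := fun π : A →ₗ[F] A =>
    AxisData (axisType F a).1 (axisType F a).2 a (axisCoord F a) π)
    (Classical.epsilon_spec (p := fun φ : A →ₗ[F] F =>
      ∃ π, AxisData (axisType F a).1 (axisType F a).2 a φ π) ha.isPrimitiveAxis.exists_axisData)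

theorem IsAxis.miyamoto_mul (ha : IsAxis F a) (x y : A) :
    miyamoto F a (x * y) = miyamoto F a x * miyamoto F a y := by
  simp only [miyamoto_apply]
  exact ha.axisData.miyamoto_mul x y

theorem IsAxis.miyamoto_miyamoto (ha : IsAxis F a) (y : A) :
    miyamoto F a (miyamoto F a y) = y := by
  simp only [miyamoto_apply]
  exact ha.axisData.miyamoto_miyamoto y

theorem IsPrimitiveAxis.conj (ha : IsAxis F a) {l d : F} (hb : IsPrimitiveAxis l d b) :
    IsPrimitiveAxis l d (miyamoto F a b) := by
  obtain ⟨φ, π, D⟩ := hb.exists_axisData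
  exact (D.map (miyamoto F a) ha.miyamoto_mul ha.miyamoto_miyamoto).isPrimitiveAxis

theorem IsAxis.conj (ha : IsAxis F a) (hb : IsAxis F b) : IsAxis F (miyamoto F a b) := by
  obtain ⟨l, d, h⟩ := hb
  exact ⟨l, d, h.conj ha⟩

/-- Both choices are made from the same predicate, so they agree even where the type is not unique.
-/
theorem axisType_miyamoto (ha : IsAxis F a) (b : A) :
    axisType F (miyamoto F a b) = axisType F b := by
  unfold axisType
  congr 1
  ext p
  refine ⟨fun h => ?_, fun h => h.conj ha⟩
  simpa [ha.miyamoto_miyamoto] using h.conj ha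

theorem axisCoord_miyamoto (ha : IsAxis F a) (hb : IsAxis F b) (y : A) :
    axisCoord F (miyamoto F a b) y = axisCoord F b (miyamoto F a y) := by
  have D := hb.axisData.map (miyamoto F a) ha.miyamoto_mul ha.miyamoto_miyamoto
  have D' := (ha.conj hb).axisData
  rw [axisType_miyamoto ha] at D'
  exact LinearMap.congr_fun (D'.coord_unique D) y

theorem axisOdd_eq (h2 : (2 : F) ≠ 0) (a y : A) :
    axisOdd F a y = (2 : F)⁻¹ • (y - miyamoto F a y) := by
  rw [miyamoto_apply, sub_sub_cancel, smul_smul, inv_mul_cancel₀ h2, one_smul]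

/-- A primitive axial algebra of Jordan type is spanned by its axes. -/
theorem IsPAJ.span_axes (h2 : (2 : F) ≠ 0) (hA : IsPAJ F A) :
    Submodule.span F {b : A | IsAxis F b} = ⊤ := by
  obtain ⟨X, hX, hgen⟩ := hA
  set V := Submodule.span F {b : A | IsAxis F b}
  have hτ (b : A) (hb : IsAxis F b) (y : A) (hy : y ∈ V) : miyamoto F b y ∈ V := by
    refine Submodule.span_induction (fun d hd => Submodule.subset_span (hb.conj hd))
      (by rw [map_zero]; exact V.zero_mem) (fun x y _ _ hx hy => ?_) (fun r x _ hx => ?_) hy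
    · rw [map_add]; exact V.add_mem hx hy
    · rw [map_smul]; exact V.smul_mem r hx
  -- Since π_b = (1 - τ_b)/2, multiplication by b preserves any τ_b-invariant subspace containing b.
  have hb (b : A) (hb : IsAxis F b) (y : A) (hy : y ∈ V) : b * y ∈ V := by
    rw [hb.axisData.mul_left, axisOdd_eq h2]
    exact V.add_mem (V.smul_mem _ (Submodule.subset_span hb))
      (V.smul_mem _ (V.smul_mem _ (V.sub_mem hy (hτ b hb y hy))))
  have hmul (x y : A) (hx : x ∈ V) (hy : y ∈ V) : x * y ∈ V := by
    refine Submodule.span_induction (fun d hd => hb d hd y hy)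
      (by rw [zero_mul]; exact V.zero_mem) (fun x z _ _ hx hz => ?_) (fun r x _ hx => ?_) hx
    · rw [add_mul]; exact V.add_mem hx hz
    · rw [smul_mul_assoc]; exact V.smul_mem r hx
  rw [eq_top_iff]
  intro y _
  have hy : y ∈ NonUnitalAlgebra.adjoin F X := by rw [hgen]; trivial
  refine NonUnitalAlgebra.adjoin_induction (p := fun y _ => y ∈ V)
    (fun x hx => Submodule.subset_span (hX x hx)) (fun x y _ _ hx hy => V.add_mem hx hy)
    V.zero_mem (fun x y _ _ hx hy => hmul x y hx hy) (fun r x _ hx => V.smul_mem r hx) hy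

/-! ### Bilinear forms from weights -/

/-- A family of functionals indexed by a spanning set, whose matrix of values on that set is
symmetric, extends to a linear map into the dual. -/
theorem exists_linearMap_of_symm {K V : Type*} [Field K] [AddCommGroup V] [Module K V]
    {S : Set V} (hS : Submodule.span K S = ⊤) (f : V → V →ₗ[K] K)
    (hf : ∀ b ∈ S, ∀ d ∈ S, f b d = f d b) : ∃ T : V →ₗ[K] V →ₗ[K] K, ∀ b ∈ S, T b = f b := by
  let B := Module.Basis.ofSpan hS.ge
  have hB (i) : B i ∈ S := Module.Basis.ofSpan_subset hS.ge ⟨i, rfl⟩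
  let T : V →ₗ[K] V →ₗ[K] K := B.constr K fun i => f (B i)
  have hT (i) : T (B i) = f (B i) := B.constr_basis K _ i
  refine ⟨T, fun b hb => B.ext fun j => ?_⟩
  -- `T` is prescribed only on a basis inside `S`; symmetry transfers its values to the rest of `S`.
  have : T.flip (B j) = f (B j) := B.ext fun i => by
    rw [LinearMap.flip_apply, hT, hf _ (hB i) _ (hB j)]
  rw [hf b hb _ (hB j), ← this, LinearMap.flip_apply]

/-- A Miyamoto invariant symmetrizing weight on the axes that does not vanish at `a` forces
`A_0(a)` to be a subalgebra. -/
theorem mul_mem_zeroSpace_of_weight (h2 : (2 : F) ≠ 0) (hA : IsPAJ F A) (c : A → F)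
    (hsymm : ∀ b d, IsAxis F b → IsAxis F d → c b * axisCoord F b d = c d * axisCoord F d b)
    (hinv : ∀ b d, IsAxis F b → IsAxis F d → c (miyamoto F b d) = c d)
    (ha : IsAxis F a) (hca : c a ≠ 0) {x y : A} (hx : x ∈ zeroSpace F a)
    (hy : y ∈ zeroSpace F a) : x * y ∈ zeroSpace F a := by
  have hspan := hA.span_axes h2
  obtain ⟨T, hT⟩ := exists_linearMap_of_symm hspan (fun b => c b • axisCoord F b)
    (fun b hb d hd => by simpa using hsymm b d hb hd)
  -- For an axis x = b, the odd parts match by invariance of the form under τ_b, and the coordinate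
  -- parts by symmetry of the weighted coordinates.
  have key (x : A) : T a (x * y) = T (x * a) y := by
    have hx : x ∈ Submodule.span F {b : A | IsAxis F b} := by rw [hspan]; trivial
    induction hx using Submodule.span_induction with
    | mem b hb =>
      have hb : IsAxis F b := hb
      have e1 : T (miyamoto F b a) y = T a (miyamoto F b y) := by
        rw [hT _ (hb.conj ha), hT _ ha, LinearMap.smul_apply, LinearMap.smul_apply,
          axisCoord_miyamoto hb ha, hinv b a hb ha]
      have e2 := hsymm a b ha hb
      rw [hb.axisData.mul_left y, hb.axisData.mul_left a, axisOdd_eq h2, axisOdd_eq h2]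
      simp only [map_add, map_smul, map_sub, LinearMap.add_apply, LinearMap.smul_apply,
        LinearMap.sub_apply, e1]
      rw [hT _ hb, hT _ ha]
      simp only [LinearMap.smul_apply, smul_eq_mul]
      linear_combination axisCoord F b y * e2
    | zero => simp
    | add x z _ _ hx hz => simp [add_mul, hx, hz]
    | smul r x _ hx => simp [smul_mul_assoc, hx]
  have D := ha.axisData
  have h1 := key x
  rw [(mem_zeroSpace.1 hx).2, map_zero, hT _ ha] at h1
  have h1 : c a * axisCoord F a (x * y) = 0 := h1
  rw [D.mem_zeroSpace_iff] at *
  refine ⟨(mul_eq_zero.1 h1).resolve_left hca, ?_⟩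
  rw [D.odd_mul, hx.2, hy.2, zero_mul, mul_zero, add_zero]

end

/-! ### Frobenius forms and the two weights -/

section

variable {F A : Type*} [Field F] [NonUnitalNonAssocRing A] [Module F A]
  [IsScalarTower F A A] [SMulCommClass F A A] {a b : A}

omit [IsScalarTower F A A] [SMulCommClass F A A] in
/-- For an axis `a`, `(a, y) = φ(y) (a, a)` with respect to every Frobenius form. -/
theorem AxisData.frobenius_left {l d : F} {φ : A →ₗ[F] F} {π : A →ₗ[F] A}
    (D : AxisData l d a φ π) {B : LinearMap.BilinForm F A} (hB : IsFrobeniusForm B) (y : A) :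
    B a y = φ y * B a a := by
  have h1 (y : A) : B a y = φ y * B a a + l * B a (π y) := by
    have := hB.2 a a y
    rw [D.idem, D.mul_left y, map_add, map_smul, map_smul] at this
    exact this.symm
  have h3 := h1 (π y)
  rw [D.coord_odd, D.odd_odd, zero_mul, zero_add] at h3
  have h4 : (l - 1) * B a (π y) = 0 := by linear_combination -h3
  rw [h1 y, (mul_eq_zero.1 h4).resolve_left (sub_ne_zero.2 D.l_ne_one), mul_zero, add_zero]

-- Needed separately because a Frobenius form is not assumed symmetric.
omit [IsScalarTower F A A] [SMulCommClass F A A] in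
theorem AxisData.frobenius_right {l d : F} {φ : A →ₗ[F] F} {π : A →ₗ[F] A}
    (D : AxisData l d a φ π) {B : LinearMap.BilinForm F A} (hB : IsFrobeniusForm B) (y : A) :
    B y a = φ y * B a a := by
  have h1 (y : A) : B y a = φ y * B a a + d * B (π y) a := by
    have := hB.2 y a a
    rw [D.idem, D.mul_right y, map_add, map_smul, map_smul] at this
    exact this
  have h3 := h1 (π y)
  rw [D.coord_odd, D.odd_odd, zero_mul, zero_add] at h3
  have h4 : (d - 1) * B (π y) a = 0 := by linear_combination -h3
  rw [h1 y, (mul_eq_zero.1 h4).resolve_left (sub_ne_zero.2 D.d_ne_one), mul_zero, add_zero]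

theorem IsAxis.axisData_of_axisType (ha : IsAxis F a) {l d : F} (h : axisType F a = (l, d)) :
    AxisData l d a (axisCoord F a) (axisOdd F a) := by
  simpa [h] using ha.axisData

/-- The coordinates of axes of types `-1` and `2` that do not annihilate each other. -/
theorem AxisData.coord_of_neg_one_two (h2 : (2 : F) ≠ 0) (h3 : (3 : F) ≠ 0) {φ φ' : A →ₗ[F] F}
    {π π' : A →ₗ[F] A} (D : AxisData (-1) (-1) a φ π) (D' : AxisData 2 2 b φ' π')
    (hne : a ≠ b) (hab : a * b ≠ 0) : φ b = 3 / 2 ∧ φ' a = 0 := by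
  rcases D.pair_classification h2 D' with h | h | h | h
  · exact absurd h hne
  · exact absurd h.2.2.1 hab
  · exact absurd (by linear_combination -h.1) h3
  · exact ⟨by rw [h.2.2.1]; norm_num, by rw [h.2.2.2]; norm_num⟩

theorem mul_mem_zeroSpace_of_axisType (h2 : (2 : F) ≠ 0) (hA : IsPAJ F A) (ha : IsAxis F a)
    (h : axisType F a = (-1, -1) → (-1 : F) = 1 / 2) {x y : A} (hx : x ∈ zeroSpace F a)
    (hy : y ∈ zeroSpace F a) : x * y ∈ zeroSpace F a := by
  classical
  -- The exceptional pairs never involve type 1/2, so it may keep weight 1; this matters in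
  -- characteristic 3, where 1 + 1/2 = 0.
  let c : F × F → F := fun t => if t.1 = t.2 ∧ t.1 ≠ 1 / 2 then 1 + t.1 else 1
  have hc : ∀ t, c t = 0 → t = (-1, -1) ∧ (-1 : F) ≠ 1 / 2 := by
    rintro ⟨l, m⟩ h
    by_cases hlm : l = m ∧ l ≠ 1 / 2
    · have h' : 1 + l = 0 := by simpa only [c, if_pos hlm] using h
      have hl : l = -1 := by linear_combination h'
      rw [← hlm.1, hl]
      exact ⟨rfl, hl ▸ hlm.2⟩
    · exact absurd (by simpa only [c, if_neg hlm] using h) one_ne_zero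
  refine mul_mem_zeroSpace_of_weight h2 hA (fun b => c (axisType F b)) (fun b d hb hd => ?_)
    (fun b d hb hd => by rw [axisType_miyamoto hb]) ha
    (fun h0 => (hc _ h0).2 (h (hc _ h0).1)) hx hy
  rcases eq_or_ne b d with rfl | hne
  · rfl
  have D := hb.axisData
  have D' := hd.axisData
  generalize axisType F b = t at *
  generalize axisType F d = t' at *
  obtain ⟨l, m⟩ := t
  obtain ⟨l', m'⟩ := t'
  dsimp only at D D' ⊢
  by_cases hlm : l = m <;> by_cases hlm' : l' = m'
  · subst hlm hlm'
    rcases (D.pair_classification h2 D').resolve_left hne with h | h | h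
    · rw [h.1, h.2.1, mul_zero, mul_zero]
    · rw [h.1, h.2]
    · have hl' : l' ≠ 1 / 2 := fun e => h.2.1 (by
        have := h.1
        rw [e] at this
        field_simp at this ⊢
        linear_combination this)
      simp only [c, if_pos (And.intro rfl h.2.1), if_pos (And.intro rfl hl'), h.2.2.1, h.2.2.2]
      ring
  · obtain ⟨h, h'⟩ := (D'.coord_eq_of_ne D hlm' hlm).resolve_left hne.symm
    rw [h, h', mul_zero, mul_zero]
  · obtain ⟨h, h'⟩ := (D.coord_eq_of_ne D' hlm hlm').resolve_left hne
    rw [h, h', mul_zero, mul_zero]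
  · simp only [c, hlm, hlm', false_and, if_false]
    rw [D.coord_eq_of_noncomm D' hlm hlm']

/-- An axis of type `-1` annihilating all axes of type `2` annihilates every axis of type `-1`
that does not annihilate some axis of type `2`. -/
theorem mul_eq_zero_of_mul_ne_zero (h2 : (2 : F) ≠ 0) (h3 : (3 : F) ≠ 0) {d e : A}
    (hb : ∀ e, IsAxis F e → axisType F e = (2, 2) → b * e = 0) (hd : IsAxis F d)
    (htd : axisType F d = (-1, -1)) (he : IsAxis F e) (hte : axisType F e = (2, 2))
    (hde : d * e ≠ 0) : b * d = 0 := by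
  have D := hd.axisData_of_axisType htd
  have E := he.axisData_of_axisType hte
  have hne : d ≠ e := by
    rintro rfl
    rw [htd] at hte
    exact h3 (by linear_combination -(Prod.ext_iff.1 hte).1)
  obtain ⟨h32, h0⟩ := D.coord_of_neg_one_two h2 h3 E hne hde
  have hbe := hb e he hte
  -- As τ_d(e) also has type 2, b annihilates both e and τ_d(e), hence π_d(e).
  have hbe' := hb _ (hd.conj he) (by rw [axisType_miyamoto hd, hte])
  rw [miyamoto_apply, mul_sub, mul_smul_comm, hbe, zero_sub, neg_eq_zero, smul_eq_zero,
    or_iff_right h2] at hbe'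
  have e1 : b * (d * e) = (3 / 2 : F) • (b * d) := by
    rw [D.mul_left, mul_add, mul_smul_comm, mul_smul_comm, hbe', h32, smul_zero, add_zero]
  have e2 : miyamoto F e d = d - d * e := by
    rw [miyamoto_apply, E.mul_right d, h0, zero_smul, zero_add]
  have e3 : miyamoto F e b = b := by
    have := congrArg (axisOdd F e) (E.mul_right b)
    rw [hbe, map_add, map_smul, map_smul, E.odd_self, E.odd_odd, map_zero, smul_zero,
      zero_add] at this
    rw [miyamoto_apply, ← this, sub_zero]
  -- τ_e fixes b and sends d to d - de, while b(de) = (3/2)bd. So bd is scaled by -1/2 under an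
  -- involution, forcing 3bd = 0.
  have e4 : miyamoto F e (b * d) = (-1 / 2 : F) • (b * d) := by
    rw [he.miyamoto_mul, e2, e3, mul_sub, e1, ← one_smul F (b * d), smul_smul, ← sub_smul,
      smul_smul]
    congr 1
    field_simp
    norm_num
  have e5 := he.miyamoto_miyamoto (b * d)
  rw [e4, map_smul, e4, smul_smul] at e5
  have e6 : (3 : F) • (b * d) = 0 := by
    have e7 : (4 : F) * (-1 / 2 * (-1 / 2)) = 1 := by field_simp; norm_num
    have e8 : (4 : F) • ((-1 / 2 * (-1 / 2) : F) • (b * d)) = b * d := by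
      rw [smul_smul, e7, one_smul]
    rw [e5] at e8
    linear_combination (norm := module) e8
  exact (smul_eq_zero.1 e6).resolve_left h3

/-- The weight is the indicator of the class `P` of type -1 axes annihilating all type 2 axes. It is
symmetrizing because a member of `P` and a different axis outside `P` have both coordinates zero. -/
theorem mul_mem_zeroSpace_of_annihilates (h2 : (2 : F) ≠ 0) (h3 : (3 : F) ≠ 0) (hA : IsPAJ F A)
    (ha : IsAxis F a) (hta : axisType F a = (-1, -1))
    (hann : ∀ e, IsAxis F e → axisType F e = (2, 2) → a * e = 0) {x y : A}
    (hx : x ∈ zeroSpace F a) (hy : y ∈ zeroSpace F a) : x * y ∈ zeroSpace F a := by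
  classical
  let P : A → Prop := fun b => axisType F b = (-1, -1) ∧
    ∀ e, IsAxis F e → axisType F e = (2, 2) → b * e = 0
  have hP (b d : A) (hb : IsAxis F b) (hd : IsAxis F d) (h : P b) :
      (P d ∧ axisCoord F b d = axisCoord F d b) ∨
        b = d ∨ (axisCoord F b d = 0 ∧ axisCoord F d b = 0) := by
    have D := hb.axisData_of_axisType h.1
    have D' := hd.axisData
    by_cases ht : (axisType F d).1 = (axisType F d).2
    · rw [← ht] at D'
      rcases D.pair_classification h2 D' with h' | h' | h' | h'
      · exact Or.inr (Or.inl h')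
      · exact Or.inr (Or.inr ⟨h'.1, h'.2.1⟩)
      · have htd : axisType F d = (-1, -1) := Prod.ext h'.1.symm (ht ▸ h'.1.symm)
        by_cases hd' : ∀ e, IsAxis F e → axisType F e = (2, 2) → d * e = 0
        · exact Or.inl ⟨⟨htd, hd'⟩, h'.2⟩
        · push Not at hd'
          obtain ⟨e, he, hte, hde⟩ := hd'
          have h0 := mul_eq_zero_of_mul_ne_zero h2 h3 h.2 hd htd he hte hde
          have h1 := congrArg (axisCoord F b) (D.mul_left d)
          rw [h0, map_add, map_smul, map_smul, D.coord_self, D.coord_odd, map_zero, smul_zero,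
            add_zero, smul_eq_mul, mul_one] at h1
          exact Or.inr (Or.inr ⟨h1.symm, h'.2 ▸ h1.symm⟩)
      -- The exceptional pair: φ_b(d) = 0 since bd = 0, and φ_d(b) = (1 + (-1))/2 = 0.
      · have ht2 : (axisType F d).1 = 2 := by linear_combination h'.1
        have h0 := h.2 d hd (Prod.ext ht2 (ht ▸ ht2))
        have h1 := congrArg (axisCoord F b) (D.mul_left d)
        rw [h0, map_add, map_smul, map_smul, D.coord_self, D.coord_odd, map_zero, smul_zero,
          add_zero, smul_eq_mul, mul_one] at h1
        exact Or.inr (Or.inr ⟨h1.symm, by rw [h'.2.2.2]; norm_num⟩)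
    · rcases D'.coord_eq_of_ne D ht rfl with h' | h'
      · exact Or.inr (Or.inl h'.symm)
      · exact Or.inr (Or.inr h'.symm)
  have hPm (b d : A) (hb : IsAxis F b) (h : P d) : P (miyamoto F b d) := by
    refine ⟨by rw [axisType_miyamoto hb, h.1], fun e he hte => ?_⟩
    have := h.2 _ (hb.conj he) (by rw [axisType_miyamoto hb, hte])
    rw [← hb.miyamoto_miyamoto e, ← hb.miyamoto_mul, this, map_zero]
  refine mul_mem_zeroSpace_of_weight h2 hA (fun b => if P b then 1 else 0)
    (fun b d hb hd => ?_) (fun b d hb hd => ?_) ha ?_ hx hy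
  · by_cases h : P b
    · rcases hP b d hb hd h with h' | h' | h'
      · simp only [if_pos h, if_pos h'.1, h'.2]
      · rw [h']
      · rw [h'.1, h'.2, mul_zero, mul_zero]
    · by_cases h' : P d
      · rcases hP d b hd hb h' with h' | h' | h'
        · exact absurd h'.1 h
        · rw [h']
        · rw [h'.1, h'.2, mul_zero, mul_zero]
      · simp only [if_neg h, if_neg h', zero_mul]
  · have : P (miyamoto F b d) ↔ P d :=
      ⟨fun h => by simpa only [hb.miyamoto_miyamoto] using hPm b _ hb h, hPm b d hb⟩
    simp only [this]
  · rw [if_pos (show P a from ⟨hta, hann⟩)]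
    exact one_ne_zero

end

theorem theoremA02 {F A : Type*} [Field F] [NonUnitalNonAssocRing A] [Module F A]
    [IsScalarTower F A A] [SMulCommClass F A A] (hF : ringChar F ≠ 2) (hA : IsPAJ F A)
    (a : A) (ha : ∃ lam del : F, IsPrimitiveAxis lam del a) :
    (∀ x ∈ zeroSpace F a, ∀ y ∈ zeroSpace F a, x * y ∈ zeroSpace F a) ∨
    (IsPrimitiveAxis (-1 : F) (-1) a ∧ (-1 : F) ≠ 1 / 2 ∧
      (∃ b : A, IsPrimitiveAxis (2 : F) 2 b ∧ a * b ≠ 0) ∧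
      ∀ B : LinearMap.BilinForm F A, IsFrobeniusForm B → a ∈ formRadical B) := by
  have h2 : (2 : F) ≠ 0 := Ring.two_ne_zero hF
  have ha : IsAxis F a := ha
  by_cases hta : axisType F a = (-1, -1) → (-1 : F) = 1 / 2
  · exact Or.inl fun x hx y hy => mul_mem_zeroSpace_of_axisType h2 hA ha hta hx hy
  obtain ⟨hta, hhalf⟩ := Classical.not_imp.1 hta
  have h3 : (3 : F) ≠ 0 := fun h => hhalf (by field_simp; linear_combination -h)
  by_cases hann : ∀ e, IsAxis F e → axisType F e = (2, 2) → a * e = 0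
  · exact Or.inl fun x hx y hy => mul_mem_zeroSpace_of_annihilates h2 h3 hA ha hta hann hx hy
  push Not at hann
  obtain ⟨b, hb, htb, hab⟩ := hann
  have D := ha.axisData_of_axisType hta
  have E := hb.axisData_of_axisType htb
  refine Or.inr ⟨D.isPrimitiveAxis, hhalf, ⟨b, E.isPrimitiveAxis, hab⟩, fun B hB v => ?_⟩
  have hne : a ≠ b := by
    rintro rfl
    rw [hta] at htb
    exact h3 (by linear_combination -(Prod.ext_iff.1 htb).1)
  obtain ⟨h32, h0⟩ := D.coord_of_neg_one_two h2 h3 E hne hab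
  -- Evaluating (a, b) through either axis gives (3/2)(a, a) = 0 · (b, b).
  have e1 := E.frobenius_right hB a
  rw [D.frobenius_left hB b, h32, h0, zero_mul] at e1
  rw [D.frobenius_left hB v,
    (mul_eq_zero.1 e1).resolve_left (div_ne_zero h3 h2), mul_zero]
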